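/- Notation: $\mathbb N=\{1,2,\dots\}$, $(\Omega,\mathcal A,\mathbb P)$ is a probability space, and for $q\in[1,\infty)$ the Khintchine constant $B_q\in(0,\infty)$ is the smallest positive number such that $\bigl\|\sum_{j=1}^n r_ja_j\bigr\|_{L^q}\le B_q\bigl(\sum_{j=1}^n a_j^2\bigr)^{1/2}$ for every $n$, all $a_1,\dots,a_n\in\mathbb R$ and every family $(r_j)_{j\in\mathbb N}$ of independent random variables with $\mathbb P(r_j=1)=\mathbb P(r_j=-1)=\tfrac12$. A $\sigma$-finite measure space $(S,\mathcal S,\mu)$ has the approximation-by-averaging property if for every $n\in\mathbb N$ there is a finite or countably infinite family $\{B^n_\kappa:\kappa\in\mathscr K_n\}$ of pairwise disjoint measurable sets of positive, finite measure such that, for every Banach space $E$, every $p\in[1,\infty)$ and every $f\in L^p(S;E)$, the functions $f_n:=\sum_{\kappa\in\mathscr K_n}\mathbf 1_{B^n_\kappa}\,\mu(B^n_\kappa)^{-1}\int_{B^n_\kappa}f\,\mathrm d\mu$ converge to $f$ in $L^p(S;E)$. For a strongly measurable $\eta\colon\Omega\to L^p(S)$ let $\widetilde\eta\colon S\times\Omega\to\mathbb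 R$ be a jointly measurable function with $\eta(\omega)=\widetilde\eta(\cdot,\omega)$ in $L^p(S)$ for $\mathbb P$-almost all $\omega$ (it is unique up to $\mu\otimes\mathbb P$-null sets); $\eta\in L^p(S;L^q(\Omega))$ means that $s\mapsto\widetilde\eta(s,\cdot)$ belongs to this Bochner space, and $\|\eta\|_{L^p(S;L^q(\Omega))}=\bigl(\int_S(\int_\Omega|\widetilde\eta(s,\omega)|^q\,\mathrm d\mathbb P(\omega))^{p/q}\,\mathrm d\mu(s)\bigr)^{1/p}$. Theorem. Let $(S,\mathcal S,\mu)$ be a $\sigma$-finite measure space with the approximation-by-averaging property. Let $p\in[1,\infty)$, $q\in[p,\infty)$, $\widetilde q\in[q,\infty)$, $L\in\mathbb N$, and set $\bar q:=\min\{q,2\}$, $\widehat q:=\min\{\widetilde q,2\}$. Suppose that for every $\ell\in\{1,\dots,L\}$ we have $X_\ell\in L^{\widetilde q}(\Omega;L^p(S))\cap L^p(S;L^{\widetilde q}(\Omega))$, $M_\ell\in\mathbb N$, and that $\xi_{\ell,1},\dots,\xi_{\ell,M_\ell}$ are independent copies, defined on $\Omega$, of the $L^p(S)$-valued random variable $\xi_\ell:=X_\ell-X_{\ell-1}$,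 where $X_0:=0$. Then, for every $U\in L^p(S)$ and all $r\in[\bar q,\widehat q]$, the random variable $U-\sum_{\ell=1}^L\frac1{M_\ell}\sum_{j=1}^{M_\ell}\xi_{\ell,j}$ is in $L^q(\Omega;L^p(S))$, all the norms below are finite, and $$\Bigl\|U-\sum_{\ell=1}^L\frac1{M_\ell}\sum_{j=1}^{M_\ell}\xi_{\ell,j}\Bigr\|_{L^q(\Omega;L^p(S))}\le\|U-\mathbb E[X_L]\|_{L^p(S)}+2B_q\sum_{\ell=1}^L M_\ell^{-(1-\frac1r)}\bigl\|\xi_\ell-\mathbb E[\xi_\ell]\bigr\|_{L^p(S;L^{\max\{q,r\}}(\Omega))}.$$ -/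

import Mathlib

open MeasureTheory ProbabilityTheory Filter Topology
open scoped NNReal ENNReal

universe u v

/-- `(r_j)` is a Rademacher family on `(Ω', P')`: independent `{-1,1}`-valued random variables
taking both values with probability `1/2`. -/
structure IsRademacherFamily {Ω' : Type*} [MeasurableSpace Ω'] (P' : Measure Ω')
    (r : ℕ → Ω' → ℝ) : Prop where
  measurable : ∀ j, Measurable (r j)
  values : ∀ j ω, r j ω = -1 ∨ r j ω = 1
  prob_neg_one : ∀ j, P' {ω | r j ω = -1} = 1 / 2
  prob_one : ∀ j, P' {ω | r j ω = 1} = 1 / 2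
  indep : iIndepFun r P'

/-- `B` is admissible in the upper Khintchine inequality with exponent `q`. (The law of a
Rademacher sum does not depend on the probability space, so spaces in `Type` suffice.) -/
def IsKhintchineUpperBound (q B : ℝ≥0) : Prop :=
  ∀ (Ω' : Type) [MeasurableSpace Ω'] (P' : Measure Ω') [IsProbabilityMeasure P']
    (r : ℕ → Ω' → ℝ), IsRademacherFamily P' r → ∀ (n : ℕ) (a : ℕ → ℝ),
      eLpNorm (fun ω => ∑ j ∈ Finset.range n, r j ω * a j) q P'
        ≤ B * ENNReal.ofReal (√(∑ j ∈ Finset.range n, a j ^ 2))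

/-- The Khintchine constant `B_q`: the smallest positive admissible constant. -/
noncomputable def khintchineB (q : ℝ≥0) : ℝ≥0 :=
  sInf {B : ℝ≥0 | 0 < B ∧ IsKhintchineUpperBound q B}

/-- The function `∑_{k ∈ K} 1_{B_k} (1/μ(B_k)) ∫_{B_k} f dμ`. For pairwise disjoint `B_k` at most
one summand is nonzero at each point. -/
noncomputable def averageOver {S : Type*} [MeasurableSpace S] (μ : Measure S)
    {E : Type*} [NormedAddCommGroup E] [NormedSpace ℝ E]
    (K : Set ℕ) (B : ℕ → Set S) (f : S → E) (s : S) : E :=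
  ∑' k : K, (B k).indicator (fun _ => (μ.real (B k))⁻¹ • ∫ t in B k, f t ∂μ) s

/-- The approximation-by-averaging property of `(S, μ)`: there are families
`{B n k : k ∈ K n}`, finite or countable, of pairwise disjoint measurable sets of positive finite
measure, such that for every Banach space `E`, every `p ∈ [1,∞)` and every `f ∈ L^p(S;E)` the
averages of `f` over the `n`-th family converge to `f` in `L^p(S;E)`. -/
def ApproximationByAveraging {S : Type u} [MeasurableSpace S] (μ : Measure S) : Prop :=
  ∃ (K : ℕ → Set ℕ) (B : ℕ → ℕ → Set S),
    (∀ n, ∀ k ∈ K n, MeasurableSet (B n k) ∧ 0 < μ (B n k) ∧ μ (B n k) < ∞) ∧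
    (∀ n, (K n).PairwiseDisjoint (B n)) ∧
    ∀ (E : Type v) [NormedAddCommGroup E] [NormedSpace ℝ E] [CompleteSpace E]
      (p : ℝ≥0), 1 ≤ p → ∀ f : S → E, MemLp f p μ →
        Tendsto (fun n => eLpNorm (fun s => f s - averageOver μ (K n) (B n) f s) p μ)
          atTop (𝓝 0)

section MixedNorm

variable {S Ω : Type*} [MeasurableSpace S] [MeasurableSpace Ω]

/-- `g` is a jointly measurable version of the `L^p(S)`-valued random variable `η`:
`η(ω) = g(·, ω)` in `L^p(S)` for `P`-almost every `ω`. -/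
def IsJointVersion {p : ℝ≥0∞} {μ : Measure S} (P : Measure Ω) (η : Ω → Lp ℝ p μ)
    (g : S → Ω → ℝ) : Prop :=
  Measurable (Function.uncurry g) ∧ ∀ᵐ ω ∂P, η ω =ᵐ[μ] fun s => g s ω

/-- `η ∈ L^p(S; L^q(Ω))` (Bochner space): for a jointly measurable version `g` of `η`, the map
`s ↦ g(s, ·)` is an element of `L^p(S; L^q(Ω))`. -/
def MemLpLq {p : ℝ≥0∞} {μ : Measure S} (P : Measure Ω) (η : Ω → Lp ℝ p μ) (q : ℝ≥0∞)
    [Fact (1 ≤ q)] : Prop :=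
  ∃ g : S → Ω → ℝ, IsJointVersion P η g ∧
    ∃ G : S → Lp ℝ q P, (∀ᵐ s ∂μ, G s =ᵐ[P] g s) ∧ MemLp G p μ

/-- The norm `(∫_S (∫_Ω |g(s,ω)|^q dP(ω))^{p/q} dμ(s))^{1/p}` of `η` in `L^p(S; L^q(Ω))`, where
`g` is a jointly measurable version of `η`. By `lpLqNorm_eq` the value is the same for all versions,
so that the infimum merely selects it. -/
noncomputable def lpLqNorm {p : ℝ≥0∞} {μ : Measure S} (P : Measure Ω) (η : Ω → Lp ℝ p μ)
    (q : ℝ≥0∞) : ℝ≥0∞ :=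
  ⨅ (g : S → Ω → ℝ) (_ : IsJointVersion P η g), eLpNorm (fun s => eLpNorm (g s) q P) p μ

theorem lpLqNorm_eq {p : ℝ≥0∞} {μ : Measure S} [SigmaFinite μ] {P : Measure Ω} [SigmaFinite P]
    {η : Ω → Lp ℝ p μ} {g : S → Ω → ℝ} (hg : IsJointVersion P η g) (q : ℝ≥0∞) :
    lpLqNorm P η q = eLpNorm (fun s => eLpNorm (g s) q P) p μ := by
  have key : ∀ h : S → Ω → ℝ, IsJointVersion P η h →
      eLpNorm (fun s => eLpNorm (h s) q P) p μ = eLpNorm (fun s => eLpNorm (g s) q P) p μ := by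
    intro h hh
    have h1 : ∀ᵐ ω ∂P, ∀ᵐ s ∂μ, h s ω = g s ω := by
      filter_upwards [hh.2, hg.2] with ω h₁ h₂
      filter_upwards [h₁, h₂] with s a b
      exact a.symm.trans b
    have hm : MeasurableSet {x : S × Ω | h x.1 x.2 = g x.1 x.2} :=
      measurableSet_eq_fun hh.1 hg.1
    have h2 : ∀ᵐ s ∂μ, ∀ᵐ ω ∂P, h s ω = g s ω :=
      (Measure.ae_ae_comm (μ := μ) (ν := P) (p := fun s ω => h s ω = g s ω) hm).mpr h1
    refine eLpNorm_congr_ae ?_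
    filter_upwards [h2] with s hs
    exact eLpNorm_congr_ae hs
  refine le_antisymm (iInf₂_le g hg) (le_iInf₂ fun h hh => (key h hh).ge)

end MixedNorm

/-! The family of averaging sets is not needed: a jointly measurable version of the identity on
`L^p(S)` with respect to the law of `ξ_ℓ` yields versions of the copies that are independent and
identically distributed at every point of `S`. -/

/-! Since `∑ l, 𝔼 ξ_l` telescopes to `𝔼 X_L`, the error is `U - 𝔼 X_L` minus the sum over the levels
of averages of centred independent copies. The triangle inequality in `L^q(Ω; L^p(S))` reduces the
theorem to a single level, that is, to a sum of `M` independent, identically distributed, centred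
`L^p(S)`-valued variables.

For one level, `p ≤ q` and Minkowski's integral inequality (`eLpNorm_eLpNorm_swap_le`) bound the
norm in `L^q(Ω; L^p(S))` by that in `L^p(S; L^q(Ω))`, so it remains to estimate real random
variables at fixed `s`. There symmetrization (factor 2) and Khintchine (factor `B_q`) lead to the
square function. The embedding of `ℓ^r` into `ℓ^2` for `r ≤ 2` and the power mean inequality then
give `M^(1/r)` times the norm of one summand in `L^(max q r)` (`eLpNorm_sum_le_of_identDistrib`).
Division by `M` leaves `M^(-(1 - 1/r))`.

The delicate point is that elements of `L^p(S)` have no values at points. One jointly measurable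
version `e` of the identity of `L^p(S)` under the common law serves all copies: the variables `e s
(Z j)` are the same Borel function of the different `Z j`, hence independent and identically
distributed for every `s`. For almost every `s` they are also integrable and centred, by Fubini. -/

/-! ### The Khintchine constant and Rademacher families -/

section Khintchine

theorem IsRademacherFamily.integral_eq_zero {Ω' : Type*} [MeasurableSpace Ω'] {P' : Measure Ω'}
    [IsProbabilityMeasure P'] {r : ℕ → Ω' → ℝ} (hr : IsRademacherFamily P' r) (j : ℕ) :
    ∫ ω, r j ω ∂P' = 0 := by
  have h1 : MeasurableSet {ω | r j ω = 1} := hr.measurable j (measurableSet_singleton 1)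
  have h2 : MeasurableSet {ω | r j ω = -1} := hr.measurable j (measurableSet_singleton (-1))
  have h : r j = fun ω => {ω | r j ω = 1}.indicator (fun _ => (1 : ℝ)) ω
      - {ω | r j ω = -1}.indicator (fun _ => (1 : ℝ)) ω := by
    ext ω
    rcases hr.values j ω with h | h <;> simp [Set.indicator, h] <;> norm_num
  rw [h, integral_sub ((integrable_const _).indicator h1) ((integrable_const _).indicator h2),
    integral_indicator_const _ h1, integral_indicator_const _ h2]
  simp [Measure.real, hr.prob_one, hr.prob_neg_one]

/-- By Hoeffding's lemma on `[-1, 1]` each sign has variance proxy 1. Proxies scale by `a j ^ 2` and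
add up under independence. -/
theorem IsRademacherFamily.hasSubgaussianMGF_sum {Ω' : Type*} [MeasurableSpace Ω']
    {P' : Measure Ω'} [IsProbabilityMeasure P'] {r : ℕ → Ω' → ℝ} (hr : IsRademacherFamily P' r)
    (n : ℕ) (a : ℕ → ℝ) :
    HasSubgaussianMGF (fun ω => ∑ j ∈ Finset.range n, r j ω * a j)
      (∑ j ∈ Finset.range n, ‖a j‖₊ ^ 2) P' := by
  refine HasSubgaussianMGF.sum_of_iIndepFun
    (hr.indep.comp (fun j x => x * a j) fun j => by fun_prop) fun j _ => ?_
  have h := hasSubgaussianMGF_of_mem_Icc_of_integral_eq_zero (a := -1) (b := 1)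
    (hr.measurable j).aemeasurable (ae_of_all _ fun ω => by
      rcases hr.values j ω with h | h <;> simp [h]) (hr.integral_eq_zero j)
  convert! h.const_mul (a j) using 1
  · ext ω; simp [mul_comm]
  · ext
    have h1 : ((‖(1 : ℝ) - -1‖₊ / 2) ^ 2 : ℝ≥0) = 1 := by ext; simp; norm_num
    rw [h1]
    refine Eq.trans ?_ (mul_one (a j ^ 2)).symm
    simp

/-- Without this the infimum defining `khintchineB` could be taken over the empty set. After
normalization to `∑ a_j² = 1`, the inequality `|x|^m / m! ≤ e^x + e^(-x)` and the sub-Gaussian bound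
`𝔼 e^(±g) ≤ e^(1/2)` control the moment of an integer order `m ≥ q`. -/
theorem exists_isKhintchineUpperBound (q : ℝ≥0) :
    ∃ B : ℝ≥0, 0 < B ∧ IsKhintchineUpperBound q B := by
  set m : ℕ := ⌈q⌉₊ + 1 with hm
  set K : ℝ≥0 := m.factorial * (2 * Real.toNNReal (Real.exp 2⁻¹)) with hK
  refine ⟨K ^ (1 / (m : ℝ)), ?_, ?_⟩
  · have : 0 < K := by
      have := Nat.factorial_pos m
      have := Real.toNNReal_pos.2 (Real.exp_pos 2⁻¹)
      positivity
    positivity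
  intro Ω' _ P' _ r hr n a
  set σ := √(∑ j ∈ Finset.range n, a j ^ 2) with hσ
  have hsum : 0 ≤ ∑ j ∈ Finset.range n, a j ^ 2 := Finset.sum_nonneg fun j _ => sq_nonneg _
  -- If `σ = 0`, all coefficients vanish and no normalization is possible.
  rcases (Real.sqrt_nonneg _ : 0 ≤ σ).eq_or_lt with h0 | h0
  · have h1 : ∀ j ∈ Finset.range n, a j = 0 := fun j hj => by
      have := (Finset.sum_eq_zero_iff_of_nonneg fun j _ => sq_nonneg (a j)).1
        ((Real.sqrt_eq_zero hsum).1 h0.symm) j hj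
      simpa using this
    have : (fun ω => ∑ j ∈ Finset.range n, r j ω * a j) = 0 := by
      ext ω
      exact Finset.sum_eq_zero fun j hj => by simp [h1 j hj]
    simp [this]
  set g : Ω' → ℝ := fun ω => ∑ j ∈ Finset.range n, r j ω * (a j / σ) with hg
  have hfg : (fun ω => ∑ j ∈ Finset.range n, r j ω * a j) = σ • g := by
    ext ω
    simp only [hg, Pi.smul_apply, smul_eq_mul, Finset.mul_sum]
    refine Finset.sum_congr rfl fun j _ => ?_
    have : σ ≠ 0 := h0.ne'
    field_simp
  have hgm : Measurable g :=
    Finset.measurable_fun_sum _ fun j _ => (hr.measurable j).mul_const _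
  have hsg := hr.hasSubgaussianMGF_sum n fun j => a j / σ
  have hc : ((∑ j ∈ Finset.range n, ‖a j / σ‖₊ ^ 2 : ℝ≥0) : ℝ) = 1 := by
    push_cast
    simp only [Real.norm_eq_abs, sq_abs, div_pow]
    rw [← Finset.sum_div, hσ, Real.sq_sqrt hsum, div_self]
    rintro h
    rw [h, Real.sqrt_zero] at h0
    exact h0.false
  have hE : ∀ t : ℝ, t ^ 2 = 1 → ∫⁻ ω, ENNReal.ofReal (Real.exp (t * g ω)) ∂P'
      ≤ Real.toNNReal (Real.exp 2⁻¹) := fun t ht => by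
    rw [← ofReal_integral_eq_lintegral_ofReal (hsg.integrable_exp_mul t)
      (ae_of_all _ fun ω => (Real.exp_pos _).le)]
    refine ENNReal.ofReal_le_ofReal ((hsg.mgf_le t).trans_eq ?_)
    rw [hc, ht]
    norm_num
  have hbound : ∫⁻ ω, ‖g ω‖ₑ ^ (m : ℝ) ∂P' ≤ K := by
    have h1 : ∀ ω, ‖g ω‖ₑ ^ (m : ℝ) ≤ m.factorial *
        (ENNReal.ofReal (Real.exp (1 * g ω)) + ENNReal.ofReal (Real.exp (-1 * g ω))) := fun ω => by
      rw [← ofReal_norm, Real.norm_eq_abs, ENNReal.rpow_natCast,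
        ← ENNReal.ofReal_pow (abs_nonneg _), ← ENNReal.ofReal_add (Real.exp_pos _).le
          (Real.exp_pos _).le, ← ENNReal.ofReal_natCast, ← ENNReal.ofReal_mul (by positivity)]
      refine ENNReal.ofReal_le_ofReal ?_
      have h2 := Real.pow_div_factorial_le_exp (|g ω|) (abs_nonneg _) m
      have h3 : Real.exp |g ω| ≤ Real.exp (1 * g ω) + Real.exp (-1 * g ω) := by
        rw [one_mul, neg_one_mul]
        exact Real.exp_abs_le _
      rw [div_le_iff₀' (by positivity)] at h2
      exact h2.trans (by gcongr)
    calc ∫⁻ ω, ‖g ω‖ₑ ^ (m : ℝ) ∂P' ≤ ∫⁻ ω, m.factorial *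
        (ENNReal.ofReal (Real.exp (1 * g ω)) + ENNReal.ofReal (Real.exp (-1 * g ω))) ∂P' :=
          lintegral_mono h1
      _ = m.factorial * (∫⁻ ω, ENNReal.ofReal (Real.exp (1 * g ω)) ∂P'
          + ∫⁻ ω, ENNReal.ofReal (Real.exp (-1 * g ω)) ∂P') := by
          rw [lintegral_const_mul _ (by fun_prop), lintegral_add_left (by fun_prop)]
      _ ≤ m.factorial * (Real.toNNReal (Real.exp 2⁻¹) + Real.toNNReal (Real.exp 2⁻¹)) := by
          gcongr
          · exact hE 1 (by norm_num)
          · exact hE (-1) (by norm_num)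
      _ = K := by rw [hK]; push_cast; ring
  have hqm : (q : ℝ≥0∞) ≤ (m : ℝ≥0∞) := by
    have : q ≤ (m : ℝ≥0) := (Nat.le_ceil q).trans (by rw [hm]; push_cast; simp)
    exact_mod_cast this
  have hm0 : (m : ℝ≥0∞) ≠ 0 := by simp [hm]
  rw [hfg, eLpNorm_const_smul, mul_comm, ← ofReal_norm, Real.norm_of_nonneg h0.le]
  gcongr
  refine (eLpNorm_le_eLpNorm_of_exponent_le hqm hgm.aestronglyMeasurable).trans ?_
  rw [eLpNorm_eq_lintegral_rpow_enorm_toReal hm0 (by simp), ENNReal.coe_rpow_of_nonneg _ (by positivity)]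
  simp only [ENNReal.toReal_natCast]
  gcongr

/-- The defining inequality is closed in the constant, so it survives the limit along a minimizing
sequence. -/
theorem isKhintchineUpperBound_khintchineB (q : ℝ≥0) :
    IsKhintchineUpperBound q (khintchineB q) := by
  intro Ω' _ P' _ r hr n a
  obtain ⟨B, hB⟩ := exists_isKhintchineUpperBound q
  obtain ⟨u, -, hu, hmem⟩ := exists_seq_tendsto_sInf
    (S := {B : ℝ≥0 | 0 < B ∧ IsKhintchineUpperBound q B}) ⟨B, hB⟩ (OrderBot.bddBelow _)
  refine ge_of_tendsto' (ENNReal.Tendsto.mul_const (ENNReal.tendsto_coe.2 hu)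
    (Or.inr ENNReal.ofReal_ne_top)) fun k => (hmem k).2 Ω' P' r hr n a

/-- Infinitely many fair coin tosses. A Khintchine bound quantifies over all Rademacher families and
yields something only once one exists. -/
theorem exists_isRademacherFamily :
    ∃ (Ω' : Type) (_ : MeasurableSpace Ω') (P' : Measure Ω') (_ : IsProbabilityMeasure P')
      (r : ℕ → Ω' → ℝ), IsRademacherFamily P' r := by
  let ν : Measure Bool := (PMF.uniformOfFintype Bool).toMeasure
  let f : Bool → ℝ := fun b => if b then 1 else -1
  have hf : Measurable f := measurable_of_countable _
  have key : ∀ (j : ℕ) (x : ℝ), Measure.infinitePi (fun _ : ℕ => ν) {ω | f (ω j) = x}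
      = ν {b | f b = x} := fun j x => by
    conv_rhs => rw [← Measure.infinitePi_map_eval (fun _ : ℕ => ν) j]
    rw [Measure.map_apply (measurable_pi_apply j) (hf (measurableSet_singleton x))]
    rfl
  have h1 : {b | f b = 1} = {true} := by
    ext b; cases b <;> simp [f]; norm_num
  have h2 : {b | f b = -1} = {false} := by
    ext b; cases b <;> simp [f]; norm_num
  refine ⟨ℕ → Bool, inferInstance, Measure.infinitePi fun _ => ν, inferInstance,
    fun j ω => f (ω j), fun j => hf.comp (measurable_pi_apply j), fun j ω => ?_, fun j => ?_,
    fun j => ?_, iIndepFun_infinitePi fun _ => hf⟩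
  · rcases ω j <;> simp [f]
  · rw [key, h2, PMF.toMeasure_apply_singleton _ _ (measurableSet_singleton _)]
    simp
  · rw [key, h1, PMF.toMeasure_apply_singleton _ _ (measurableSet_singleton _)]
    simp

end Khintchine

/-! ### Symmetrization and Khintchine for centred independent variables -/

section Symmetrization

variable {Ω : Type*} [MeasurableSpace Ω] {P : Measure Ω} [IsProbabilityMeasure P]

/-- Jensen: for fixed `x`, `|x| = |𝔼 (x + W)| ≤ ‖x + W‖_1 ≤ ‖x + W‖_q`. By independence this may be
integrated over the law of `V`. -/
theorem eLpNorm_le_eLpNorm_add_of_indepFun {V W : Ω → ℝ} (hV : Measurable V) (hW : Measurable W)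
    (hVW : IndepFun V W P) (hint : Integrable W P) (hmean : ∫ ω, W ω ∂P = 0) {q : ℝ≥0}
    (hq : 1 ≤ q) : eLpNorm V q P ≤ eLpNorm (V + W) q P := by
  have hq0 : q ≠ 0 := (zero_lt_one.trans_le hq).ne'
  have hq0' : (0 : ℝ) < q := by positivity
  have := Measure.isProbabilityMeasure_map (μ := P) hW.aemeasurable
  have := Measure.isProbabilityMeasure_map (μ := P) hV.aemeasurable
  rw [← ENNReal.rpow_le_rpow_iff hq0', eLpNorm_nnreal_pow_eq_lintegral hq0,
    eLpNorm_nnreal_pow_eq_lintegral hq0]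
  have h1 : ∫⁻ ω, ‖(V + W) ω‖ₑ ^ (q : ℝ) ∂P
      = ∫⁻ x, ∫⁻ y, ‖x + y‖ₑ ^ (q : ℝ) ∂(P.map W) ∂(P.map V) := by
    rw [lintegral_lintegral (f := fun x y => ‖x + y‖ₑ ^ (q : ℝ)) (by fun_prop),
      ← hVW.map_prod_eq_prod_map_map hV.aemeasurable hW.aemeasurable,
      lintegral_map (by fun_prop) (hV.prodMk hW)]
    rfl
  have h2 : ∫⁻ ω, ‖V ω‖ₑ ^ (q : ℝ) ∂P = ∫⁻ x, ‖x‖ₑ ^ (q : ℝ) ∂(P.map V) := by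
    rw [lintegral_map (by fun_prop) hV]
  rw [h1, h2]
  refine lintegral_mono fun x => ?_
  have hintW : Integrable (fun y : ℝ => y) (P.map W) :=
    (integrable_map_measure (by fun_prop) hW.aemeasurable).2 hint
  have hx : ∫ y, (x + y) ∂(P.map W) = x := by
    have hW0 : ∫ y, y ∂(P.map W) = 0 := (integral_map hW.aemeasurable (by fun_prop)).trans hmean
    rw [integral_add (integrable_const _) hintW, hW0]
    simp
  rw [← eLpNorm_nnreal_pow_eq_lintegral (f := fun y => x + y) hq0]
  gcongr
  calc ‖x‖ₑ = ‖∫ y, (x + y) ∂(P.map W)‖ₑ := by rw [hx]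
    _ ≤ ∫⁻ y, ‖x + y‖ₑ ∂(P.map W) := enorm_integral_le_lintegral_enorm _
    _ = eLpNorm (fun y => x + y) 1 (P.map W) := eLpNorm_one_eq_lintegral_enorm.symm
    _ ≤ _ := eLpNorm_le_eLpNorm_of_exponent_le (by exact_mod_cast hq) (by fun_prop)

variable {ι : Type*} [Fintype ι] {y : ι → Ω → ℝ}

/-- No independent copy is needed. With `V` and `W` the sums over the indices of sign `1` and `-1`,
the signed sum is `V - W`. It dominates both `V` and `W` in norm by the preceding lemma, and the
factor 2 comes from the triangle inequality for `V + W`. -/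
theorem eLpNorm_sum_le_two_mul_eLpNorm_sum_signs (hy : ∀ i, Measurable (y i))
    (hindep : iIndepFun y P) (hint : ∀ i, Integrable (y i) P) (hmean : ∀ i, ∫ ω, y i ω ∂P = 0)
    {q : ℝ≥0} (hq : 1 ≤ q) {ε : ι → ℝ} (hε : ∀ i, ε i = -1 ∨ ε i = 1) :
    eLpNorm (fun ω => ∑ i, y i ω) q P ≤ 2 * eLpNorm (fun ω => ∑ i, ε i * y i ω) q P := by
  classical
  set J : Finset ι := Finset.univ.filter fun i => ε i = 1
  set V : Ω → ℝ := fun ω => ∑ i ∈ J, y i ω with hV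
  set W : Ω → ℝ := fun ω => ∑ i ∈ Jᶜ, y i ω with hW
  have hVm : Measurable V := Finset.measurable_fun_sum _ fun i _ => hy i
  have hWm : Measurable W := Finset.measurable_fun_sum _ fun i _ => hy i
  have hsum : (fun ω => ∑ i, y i ω) = V + W := by
    ext ω
    exact (Finset.sum_add_sum_compl J fun i => y i ω).symm
  have hsign : (fun ω => ∑ i, ε i * y i ω) = V + -W := by
    ext ω
    rw [← Finset.sum_add_sum_compl J fun i => ε i * y i ω]
    simp only [Pi.add_apply, Pi.neg_apply, hV, hW, ← Finset.sum_neg_distrib]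
    congr 1
    · exact Finset.sum_congr rfl fun i hi => by rw [(Finset.mem_filter.1 hi).2, one_mul]
    · refine Finset.sum_congr rfl fun i hi => ?_
      have : ε i ≠ 1 := by simpa [J] using hi
      rw [(hε i).resolve_right this, neg_one_mul]
  have hVW : IndepFun V W P := by
    have h := (hindep.indepFun_finset J Jᶜ disjoint_compl_right hy).comp
      (φ := fun x : J → ℝ => ∑ i, x i) (ψ := fun x : (Jᶜ : Finset ι) → ℝ => ∑ i, x i)
      (by fun_prop) (by fun_prop)
    convert h using 1
    · ext ω; simp only [hV, Function.comp]; rw [← Finset.sum_coe_sort]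
    · ext ω; simp only [hW, Function.comp]; rw [← Finset.sum_coe_sort]
  have hVi : Integrable V P := integrable_finsetSum _ fun i _ => hint i
  have hWi : Integrable W P := integrable_finsetSum _ fun i _ => hint i
  have hV0 : ∫ ω, V ω ∂P = 0 := by
    rw [integral_finsetSum _ fun i _ => hint i]; exact Finset.sum_eq_zero fun i _ => hmean i
  have hW0 : ∫ ω, (-W) ω ∂P = 0 := by
    simp only [Pi.neg_apply]
    rw [integral_neg, integral_finsetSum _ fun i _ => hint i, Finset.sum_eq_zero fun i _ => hmean i,
      neg_zero]
  have hVW' : IndepFun V (-W) P := hVW.comp measurable_id measurable_neg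
  have h1 := eLpNorm_le_eLpNorm_add_of_indepFun hVm hWm.neg hVW' hWi.neg hW0 hq
  have h2 := eLpNorm_le_eLpNorm_add_of_indepFun hWm.neg hVm hVW'.symm hVi hV0 hq
  rw [eLpNorm_neg, add_comm] at h2
  rw [hsum, hsign, two_mul]
  refine (eLpNorm_add_le hVm.aestronglyMeasurable hWm.aestronglyMeasurable
    (by exact_mod_cast hq)).trans (add_le_add h1 h2)

/-- The bound for deterministic signs is averaged over Rademacher signs on an auxiliary space. After
Tonelli, Khintchine applies for each fixed `ω` with coefficients `y i ω`. -/
theorem eLpNorm_sum_le_two_mul_khintchineB_mul {M : ℕ} {y : Fin M → Ω → ℝ}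
    (hy : ∀ i, Measurable (y i))
    (hindep : iIndepFun y P) (hint : ∀ i, Integrable (y i) P) (hmean : ∀ i, ∫ ω, y i ω ∂P = 0)
    {q : ℝ≥0} (hq : 1 ≤ q) :
    eLpNorm (fun ω => ∑ i, y i ω) q P
      ≤ 2 * khintchineB q * eLpNorm (fun ω => √(∑ i, y i ω ^ 2)) q P := by
  have hq0 : q ≠ 0 := (zero_lt_one.trans_le hq).ne'
  have hq0' : (0 : ℝ) < q := by positivity
  obtain ⟨Ω', _, P', _, r, hr⟩ := exists_isRademacherFamily
  rw [← ENNReal.rpow_le_rpow_iff hq0', ENNReal.mul_rpow_of_nonneg _ _ hq0'.le,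
    ENNReal.mul_rpow_of_nonneg _ _ hq0'.le, eLpNorm_nnreal_pow_eq_lintegral hq0,
    eLpNorm_nnreal_pow_eq_lintegral hq0]
  have hm : Measurable (fun z : Ω' × Ω => ‖∑ i : Fin M, r i z.1 * y i z.2‖ₑ ^ (q : ℝ)) := by
    have : ∀ i : Fin M, Measurable fun z : Ω' × Ω => r i z.1 * y i z.2 := fun i =>
      ((hr.measurable i).comp measurable_fst).mul ((hy i).comp measurable_snd)
    fun_prop
  have h1 : ∀ ω', ∫⁻ ω, ‖∑ i, y i ω‖ₑ ^ (q : ℝ) ∂P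
      ≤ 2 ^ (q : ℝ) * ∫⁻ ω, ‖∑ i : Fin M, r i ω' * y i ω‖ₑ ^ (q : ℝ) ∂P := fun ω' => by
    have h := eLpNorm_sum_le_two_mul_eLpNorm_sum_signs hy hindep hint hmean hq
      (ε := fun i : Fin M => r i ω') fun i => hr.values i ω'
    rw [← ENNReal.rpow_le_rpow_iff hq0', ENNReal.mul_rpow_of_nonneg _ _ hq0'.le,
      eLpNorm_nnreal_pow_eq_lintegral hq0, eLpNorm_nnreal_pow_eq_lintegral hq0] at h
    exact h
  have h2 : ∀ ω, ∫⁻ ω', ‖∑ i : Fin M, r i ω' * y i ω‖ₑ ^ (q : ℝ) ∂P'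
      ≤ (khintchineB q : ℝ≥0∞) ^ (q : ℝ) * ‖√(∑ i, y i ω ^ 2)‖ₑ ^ (q : ℝ) := fun ω => by
    -- The coefficients are extended by zero to a sequence on `ℕ`.
    have h := isKhintchineUpperBound_khintchineB q Ω' P' r hr M
      fun j => if h : j < M then y ⟨j, h⟩ ω else 0
    simp only [Finset.sum_range, Fin.is_lt, dif_pos, Fin.eta] at h
    rw [← ENNReal.rpow_le_rpow_iff hq0', ENNReal.mul_rpow_of_nonneg _ _ hq0'.le,
      eLpNorm_nnreal_pow_eq_lintegral hq0] at h
    rwa [Real.enorm_of_nonneg (Real.sqrt_nonneg _)]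
  calc ∫⁻ ω, ‖∑ i, y i ω‖ₑ ^ (q : ℝ) ∂P
      = ∫⁻ _, (∫⁻ ω, ‖∑ i, y i ω‖ₑ ^ (q : ℝ) ∂P) ∂P' := by simp
    _ ≤ ∫⁻ ω', (2 ^ (q : ℝ) * ∫⁻ ω, ‖∑ i : Fin M, r i ω' * y i ω‖ₑ ^ (q : ℝ) ∂P) ∂P' :=
        lintegral_mono h1
    _ = 2 ^ (q : ℝ) * ∫⁻ ω, ∫⁻ ω', ‖∑ i : Fin M, r i ω' * y i ω‖ₑ ^ (q : ℝ) ∂P' ∂P := by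
        rw [lintegral_const_mul _ hm.lintegral_prod_right', lintegral_lintegral_swap hm.aemeasurable]
    _ ≤ 2 ^ (q : ℝ) * ∫⁻ ω, ((khintchineB q : ℝ≥0∞) ^ (q : ℝ) *
          ‖√(∑ i, y i ω ^ 2)‖ₑ ^ (q : ℝ)) ∂P := by
        gcongr with ω
        exact h2 ω
    _ = _ := by
        rw [lintegral_const_mul _ (by fun_prop), mul_assoc]

end Symmetrization

/-! ### From the square function to the rate `M^(1/r)` -/

theorem ENNReal.sum_rpow_le_rpow_sum {ι : Type*} (s : Finset ι) (f : ι → ℝ≥0∞) {p : ℝ}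
    (hp : 1 ≤ p) : ∑ i ∈ s, f i ^ p ≤ (∑ i ∈ s, f i) ^ p := by
  classical
  induction s using Finset.induction_on with
  | empty => simp
  | insert i s hi ih =>
    rw [Finset.sum_insert hi, Finset.sum_insert hi]
    exact (add_le_add le_rfl ih).trans (ENNReal.add_rpow_le_rpow_add _ _ hp)

section SquareFunction

variable {Ω : Type*} [MeasurableSpace Ω] {P : Measure Ω} [IsProbabilityMeasure P]

/-- Superadditivity of `x ↦ x^(2/r)` on `[0, ∞]`, applied to `|a i|^r`. -/
theorem enorm_sqrt_sum_sq_le {ι : Type*} (s : Finset ι) (a : ι → ℝ) {r : ℝ} (hr : 0 < r)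
    (hr2 : r ≤ 2) : ‖√(∑ i ∈ s, a i ^ 2)‖ₑ ≤ (∑ i ∈ s, ‖a i‖ₑ ^ r) ^ (1 / r) := by
  have h1 : ‖√(∑ i ∈ s, a i ^ 2)‖ₑ = (∑ i ∈ s, (‖a i‖ₑ ^ r) ^ (2 / r)) ^ (1 / 2 : ℝ) := by
    rw [Real.enorm_of_nonneg (Real.sqrt_nonneg _), Real.sqrt_eq_rpow,
      ← ENNReal.ofReal_rpow_of_nonneg (Finset.sum_nonneg fun i _ => sq_nonneg _) (by norm_num),
      ENNReal.ofReal_sum_of_nonneg fun i _ => sq_nonneg _]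
    congr 1
    refine Finset.sum_congr rfl fun i _ => ?_
    rw [← ENNReal.rpow_mul, mul_div_cancel₀ _ hr.ne', ← sq_abs, ENNReal.ofReal_pow (abs_nonneg _),
      ← Real.norm_eq_abs, ofReal_norm]
    norm_num
  rw [h1]
  calc (∑ i ∈ s, (‖a i‖ₑ ^ r) ^ (2 / r)) ^ (1 / 2 : ℝ)
      ≤ ((∑ i ∈ s, ‖a i‖ₑ ^ r) ^ (2 / r)) ^ (1 / 2 : ℝ) := by
        gcongr
        exact ENNReal.sum_rpow_le_rpow_sum _ _ ((one_le_div hr).2 hr2)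
    _ = _ := by
        rw [← ENNReal.rpow_mul]
        congr 1
        field_simp

theorem eLpNorm_sum_le_of_identDistrib {M : ℕ} {y : Fin M → Ω → ℝ} {z : Ω → ℝ}
    (hy : ∀ i, Measurable (y i)) (hindep : iIndepFun y P) (hyz : ∀ i, IdentDistrib (y i) z P P)
    (hint : Integrable z P) (hmean : ∫ ω, z ω ∂P = 0) {q r : ℝ≥0} (hq : 1 ≤ q) (hr : 1 ≤ r)
    (hr2 : r ≤ 2) :
    eLpNorm (fun ω => ∑ i, y i ω) q P
      ≤ 2 * khintchineB q * ((M : ℝ≥0∞) ^ (1 / (r : ℝ)) * eLpNorm z (max q r : ℝ≥0) P) := by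
  have hr0 : (0 : ℝ) < r := by exact_mod_cast zero_lt_one.trans_le hr
  refine (eLpNorm_sum_le_two_mul_khintchineB_mul hy hindep
    (fun i => (hyz i).integrable_iff.2 hint) (fun i => (hyz i).integral_eq.trans hmean) hq).trans ?_
  gcongr
  -- Raising the exponent from `q` to `t` ensures `t / r ≥ 1`, as the power mean inequality below
  -- requires.
  set t : ℝ≥0 := max q r
  have ht : 1 ≤ t := hr.trans (le_max_right _ _)
  have ht0 : t ≠ 0 := (zero_lt_one.trans_le ht).ne'
  have ht0' : (0 : ℝ) < t := by positivity
  have htr : 1 ≤ (t : ℝ) / r := (one_le_div hr0).2 (by exact_mod_cast le_max_right q r)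
  refine (eLpNorm_le_eLpNorm_of_exponent_le (q := (t : ℝ≥0∞))
    (by exact_mod_cast le_max_left q r) (by fun_prop)).trans ?_
  -- Adding the exponents in `M^(t/r - 1) * M = M^(t/r)` requires `M ≠ 0`.
  rcases Nat.eq_zero_or_pos M with rfl | hM
  · simp
  rw [← ENNReal.rpow_le_rpow_iff ht0', ENNReal.mul_rpow_of_nonneg _ _ ht0'.le,
    eLpNorm_nnreal_pow_eq_lintegral ht0, eLpNorm_nnreal_pow_eq_lintegral ht0]
  have hyi : ∀ i, ∫⁻ ω, ‖y i ω‖ₑ ^ (t : ℝ) ∂P = ∫⁻ ω, ‖z ω‖ₑ ^ (t : ℝ) ∂P := fun i =>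
    ((hyz i).comp (u := fun x : ℝ => ‖x‖ₑ ^ (t : ℝ)) (by fun_prop)).lintegral_eq
  calc ∫⁻ ω, ‖√(∑ i, y i ω ^ 2)‖ₑ ^ (t : ℝ) ∂P
      ≤ ∫⁻ ω, (M : ℝ≥0∞) ^ ((t : ℝ) / r - 1) * ∑ i, ‖y i ω‖ₑ ^ (t : ℝ) ∂P := by
        refine lintegral_mono fun ω => ?_
        calc ‖√(∑ i, y i ω ^ 2)‖ₑ ^ (t : ℝ)
            ≤ ((∑ i, ‖y i ω‖ₑ ^ (r : ℝ)) ^ (1 / (r : ℝ))) ^ (t : ℝ) := by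
              gcongr
              exact enorm_sqrt_sum_sq_le _ _ hr0 (by exact_mod_cast hr2)
          _ = (∑ i, ‖y i ω‖ₑ ^ (r : ℝ)) ^ ((t : ℝ) / r) := by
              rw [← ENNReal.rpow_mul]; congr 1; ring
          _ ≤ _ := by
              refine (ENNReal.rpow_sum_le_const_mul_sum_rpow _ _ htr).trans_eq ?_
              simp only [← ENNReal.rpow_mul, mul_div_cancel₀ _ hr0.ne', Finset.card_univ,
                Fintype.card_fin]
    _ = (M : ℝ≥0∞) ^ ((t : ℝ) / r - 1) * (M * ∫⁻ ω, ‖z ω‖ₑ ^ (t : ℝ) ∂P) := by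
        rw [lintegral_const_mul _ (by fun_prop), lintegral_finsetSum _ (by fun_prop)]
        simp [hyi]
    _ = _ := by
        rw [← mul_assoc, ← ENNReal.rpow_mul]
        congr 1
        conv_lhs => rw [← ENNReal.rpow_one (M : ℝ≥0∞), ← ENNReal.rpow_mul]
        rw [one_mul, ← ENNReal.rpow_add _ _ (by exact_mod_cast hM.ne') (by simp)]
        congr 1
        ring

end SquareFunction

/-! ### Jointly measurable versions -/

section JointVersion

variable {S Ω : Type*} [MeasurableSpace S] [MeasurableSpace Ω] {μ : Measure S} {P : Measure Ω}

/-- The summable rate makes the whole sequence converge almost everywhere; a subsequence converging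
in measure and almost everywhere identifies the limit. -/
theorem MeasureTheory.Lp.ae_tendsto_of_norm_sub_lt {p : ℝ≥0∞} [hp : Fact (1 ≤ p)]
    {u : ℕ → Lp ℝ p μ} {x : Lp ℝ p μ} (h : ∀ n, ‖u n - x‖ < 2⁻¹ ^ n) :
    ∀ᵐ s ∂μ, Tendsto (fun n => u n s) atTop (𝓝 (x s)) := by
  have hlt : ∀ N n, N ≤ n → ‖u n - x‖ₑ < 2⁻¹ ^ N := fun N n hn => by
    have h1 : ‖u n - x‖ < 2⁻¹ ^ N :=
      (h n).trans_le (pow_le_pow_of_le_one (by norm_num) (by norm_num) hn)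
    rw [← ofReal_norm, ENNReal.ofReal_lt_iff_lt_toReal (norm_nonneg _)
      (ENNReal.pow_ne_top (by simp))]
    simpa using h1
  have hcau : ∀ᵐ s ∂μ, ∃ l : ℝ, Tendsto (fun n => u n s) atTop (𝓝 l) := by
    refine ae_tendsto_of_cauchy_eLpNorm (p := p) (B := fun N => 2⁻¹ ^ N + 2⁻¹ ^ N)
      (fun n => Lp.aestronglyMeasurable (u n)) hp.out ?_ fun N n m hn hm => ?_
    · rw [ENNReal.tsum_add, ENNReal.tsum_geometric]
      simp [ENNReal.one_sub_inv_two]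
    · rw [← eLpNorm_congr_ae (Lp.coeFn_sub (u n) (u m)), ← Lp.enorm_def]
      have : u n - u m = (u n - x) - (u m - x) := by abel
      rw [this]
      exact enorm_sub_le.trans_lt (ENNReal.add_lt_add (hlt N n hn) (hlt N m hm))
  have hlim : Tendsto u atTop (𝓝 x) := by
    rw [tendsto_iff_norm_sub_tendsto_zero]
    exact squeeze_zero (fun n => norm_nonneg _) (fun n => (h n).le)
      (tendsto_pow_atTop_nhds_zero_of_lt_one (by norm_num) (by norm_num))
  obtain ⟨ns, hns, hsub⟩ := (tendstoInMeasure_of_tendsto_Lp hlim).exists_seq_tendsto_ae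
  filter_upwards [hcau, hsub] with s ⟨l, hl⟩ hs
  rwa [tendsto_nhds_unique hs (hl.comp hns.tendsto_atTop)]

/-- A strongly measurable modification has separable range. Replacing its value by the first member
of a countable dense family within `2^(-n)` gives a jointly measurable function, and the limsup over
`n` is the version. -/
theorem exists_isJointVersion {p : ℝ≥0∞} [Fact (1 ≤ p)] {η : Ω → Lp ℝ p μ}
    (hη : AEStronglyMeasurable η P) : ∃ g : S → Ω → ℝ, IsJointVersion P η g := by
  classical
  obtain ⟨η', hη', hae⟩ := hη
  obtain ⟨c, hc, hsub⟩ := hη'.isSeparable_range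
  -- Inserting `0` makes the countable set nonempty, so that a sequence enumerates it.
  obtain ⟨d, hd⟩ := (hc.insert 0).exists_eq_range (Set.insert_nonempty _ _)
  have hex : ∀ (n : ℕ) (z : S × Ω), ∃ k, ‖d k - η' z.2‖ < 2⁻¹ ^ n := fun n z => by
    have h1 : η' z.2 ∈ closure (Set.range d) :=
      hd ▸ closure_mono (Set.subset_insert _ _) (hsub (Set.mem_range_self z.2))
    obtain ⟨-, ⟨k, rfl⟩, hk⟩ := Metric.mem_closure_iff.1 h1 (2⁻¹ ^ n) (by positivity)
    exact ⟨k, by rwa [dist_comm, dist_eq_norm] at hk⟩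
  let G : ℕ → S × Ω → ℝ := fun n z => d (Nat.find (hex n z)) z.1
  have hG : ∀ n, Measurable (G n) := fun n => by
    refine Measurable.find (f := fun k (z : S × Ω) => d k z.1)
      (fun k => (Lp.stronglyMeasurable (d k)).measurable.comp measurable_fst) (fun k => ?_) (hex n)
    exact measurableSet_lt (((stronglyMeasurable_const.sub hη').norm.measurable).comp measurable_snd)
      measurable_const
  refine ⟨fun s ω => limsup (fun n => G n (s, ω)) atTop, Measurable.limsup hG, ?_⟩
  filter_upwards [hae] with ω hω
  rw [hω]
  -- The chosen index depends on `ω` only, but `hex` is stated on `S × Ω`, so some point `s₀` is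
  -- needed to name it.
  rcases isEmpty_or_nonempty S with hS | ⟨⟨s₀⟩⟩
  · exact ae_of_all _ fun s => isEmptyElim s
  have h := Lp.ae_tendsto_of_norm_sub_lt (u := fun n => d (Nat.find (hex n (s₀, ω))))
    (x := η' ω) fun n => Nat.find_spec (hex n (s₀, ω))
  filter_upwards [h] with s hs
  exact hs.limsup_eq.symm

theorem lintegral_restrict_enorm_le {p : ℝ≥0∞} (hp : 1 ≤ p) (A : Set S) {f : S → ℝ}
    (hf : AEStronglyMeasurable f μ) :
    ∫⁻ s in A, ‖f s‖ₑ ∂μ ≤ eLpNorm f p μ * μ A ^ (1 - 1 / p.toReal) := by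
  rw [← eLpNorm_one_eq_lintegral_enorm]
  refine (eLpNorm_le_eLpNorm_mul_rpow_measure_univ hp hf.restrict).trans ?_
  rw [Measure.restrict_apply_univ, ENNReal.toReal_one, div_one]
  gcongr
  exact Measure.restrict_le_self

theorem measure_rpow_one_sub_lt_top {p : ℝ≥0∞} (hp : 1 ≤ p) {A : Set S} (hA : μ A < ∞) :
    μ A ^ (1 - 1 / p.toReal) < ∞ := by
  refine ENNReal.rpow_lt_top_of_nonneg ?_ hA.ne
  rcases eq_or_ne p ∞ with rfl | h
  · simp
  · have : 1 ≤ p.toReal := by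
      rw [← ENNReal.toReal_one]; exact (ENNReal.toReal_le_toReal (by simp) h).2 hp
    simp only [sub_nonneg]
    exact (div_le_one (by linarith)).2 this

/-- Integration over a set of finite measure, as a continuous linear functional on `L^p`. -/
theorem exists_clm_eq_setIntegral {p : ℝ≥0∞} [hp : Fact (1 ≤ p)] {A : Set S} (hA : μ A < ∞) :
    ∃ T : Lp ℝ p μ →L[ℝ] ℝ, ∀ f : Lp ℝ p μ, T f = ∫ s in A, f s ∂μ := by
  have hfin := measure_rpow_one_sub_lt_top hp.out hA
  have hint : ∀ f : Lp ℝ p μ, IntegrableOn f A μ := fun f =>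
    ⟨(Lp.aestronglyMeasurable f).restrict,
      (lintegral_restrict_enorm_le hp.out A (Lp.aestronglyMeasurable f)).trans_lt
        (ENNReal.mul_lt_top (Lp.memLp f).2 hfin)⟩
  let T : Lp ℝ p μ →ₗ[ℝ] ℝ :=
    { toFun := fun f => ∫ s in A, f s ∂μ
      map_add' := fun f g => by
        rw [← integral_add (hint f) (hint g)]
        exact integral_congr_ae (ae_restrict_of_ae (Lp.coeFn_add f g))
      map_smul' := fun c f => by
        rw [RingHom.id_apply, smul_eq_mul, ← integral_const_mul]
        exact integral_congr_ae (ae_restrict_of_ae (Lp.coeFn_smul c f)) }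
  refine ⟨T.mkContinuous (μ A ^ (1 - 1 / p.toReal)).toReal fun f => ?_, fun f => rfl⟩
  have h := (enorm_integral_le_lintegral_enorm (μ := μ.restrict A) (f : S → ℝ)).trans
    (lintegral_restrict_enorm_le hp.out A (Lp.aestronglyMeasurable f))
  rw [← Lp.enorm_def] at h
  have h2 := ENNReal.toReal_mono (ENNReal.mul_ne_top enorm_ne_top hfin.ne) h
  rw [ENNReal.toReal_mul, toReal_enorm, toReal_enorm, mul_comm] at h2
  exact h2

theorem IsJointVersion.integrable_uncurry_restrict [SFinite μ] [SFinite P] {p : ℝ≥0∞}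
    [hp : Fact (1 ≤ p)] {η : Ω → Lp ℝ p μ} {g : S → Ω → ℝ} (hg : IsJointVersion P η g)
    (hη : Integrable η P) {A : Set S} (hA : μ A < ∞) :
    Integrable (Function.uncurry g) ((μ.restrict A).prod P) := by
  refine ⟨hg.1.aestronglyMeasurable, ?_⟩
  have hm : Measurable fun z => ‖Function.uncurry g z‖ₑ := hg.1.enorm
  rw [HasFiniteIntegral, lintegral_prod_symm _ hm.aemeasurable]
  calc ∫⁻ ω, ∫⁻ s in A, ‖g s ω‖ₑ ∂μ ∂P
      ≤ ∫⁻ ω, ‖η ω‖ₑ * μ A ^ (1 - 1 / p.toReal) ∂P := by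
        refine lintegral_mono_ae ?_
        filter_upwards [hg.2] with ω hω
        have h := lintegral_restrict_enorm_le hp.out A (Lp.aestronglyMeasurable (η ω))
        rw [← Lp.enorm_def] at h
        refine le_trans (le_of_eq (lintegral_congr_ae (ae_restrict_of_ae ?_))) h
        filter_upwards [hω] with s hs
        rw [hs]
    _ = (∫⁻ ω, ‖η ω‖ₑ ∂P) * μ A ^ (1 - 1 / p.toReal) :=
        lintegral_mul_const' _ _ (measure_rpow_one_sub_lt_top hp.out hA).ne
    _ < ∞ := ENNReal.mul_lt_top hη.2 (measure_rpow_one_sub_lt_top hp.out hA)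

theorem IsJointVersion.ae_integrable [SigmaFinite μ] [SFinite P] {p : ℝ≥0∞}
    [Fact (1 ≤ p)] {η : Ω → Lp ℝ p μ} {g : S → Ω → ℝ} (hg : IsJointVersion P η g)
    (hη : Integrable η P) : ∀ᵐ s ∂μ, Integrable (g s) P := by
  refine ae_of_forall_measure_lt_top_ae_restrict _ fun A _ hA => ?_
  exact (hg.integrable_uncurry_restrict hη hA).prod_right_ae

/-- Integration over a set `A` of finite measure is a continuous functional and commutes with the
Bochner integral. With Fubini, `s ↦ 𝔼 g(s)` therefore integrates to zero over every such `A`. -/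
theorem IsJointVersion.ae_integral_eq_zero [SigmaFinite μ] [SFinite P] {p : ℝ≥0∞}
    [Fact (1 ≤ p)] {η : Ω → Lp ℝ p μ} {g : S → Ω → ℝ} (hg : IsJointVersion P η g)
    (hη : Integrable η P) (h0 : ∫ ω, η ω ∂P = 0) : ∀ᵐ s ∂μ, ∫ ω, g s ω ∂P = 0 := by
  refine ae_eq_zero_of_forall_setIntegral_eq_of_sigmaFinite (f := fun s => ∫ ω, g s ω ∂P)
    (fun A _ hA => (hg.integrable_uncurry_restrict hη hA).integral_prod_left) fun A _ hA => ?_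
  obtain ⟨T, hT⟩ := exists_clm_eq_setIntegral (p := p) hA
  rw [integral_integral_swap (hg.integrable_uncurry_restrict hη hA)]
  have h1 : ∫ ω, T (η ω) ∂P = 0 := by rw [T.integral_comp_comm hη, h0, map_zero]
  rw [← h1]
  refine integral_congr_ae ?_
  filter_upwards [hg.2] with ω hω
  rw [hT]
  exact (integral_congr_ae (ae_restrict_of_ae hω)).symm

end JointVersion

/-! ### Minkowski's integral inequality -/

section Minkowski

variable {S Ω : Type*} [MeasurableSpace S] [MeasurableSpace Ω] {μ : Measure S} {P : Measure Ω}
  [SFinite μ] [SFinite P]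

/-- With `H = ∫ F dμ` and `I = ∫ H^t dP`, write `I = ∫∫ F H^(t-1)` and apply Hölder in `ω`. This
gives the right-hand side times `I^(1/t')`, a factor that cancels because `I` is finite and, in the
remaining case, nonzero. -/
theorem lintegral_lintegral_rpow_le {F : S → Ω → ℝ≥0∞} (hF : Measurable (Function.uncurry F))
    {t : ℝ} (ht : 1 ≤ t) (hfin : ∫⁻ ω, (∫⁻ s, F s ω ∂μ) ^ t ∂P ≠ ∞) :
    (∫⁻ ω, (∫⁻ s, F s ω ∂μ) ^ t ∂P) ^ (1 / t) ≤ ∫⁻ s, (∫⁻ ω, F s ω ^ t ∂P) ^ (1 / t) ∂μ := by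
  rcases ht.eq_or_lt with rfl | ht
  · simp only [ENNReal.rpow_one, div_one]
    rw [lintegral_lintegral_swap hF.aemeasurable]
  have hH : Measurable fun ω => ∫⁻ s, F s ω ∂μ := hF.lintegral_prod_left'
  have hFs : ∀ s, Measurable (F s) := fun s => hF.comp measurable_prodMk_left
  set H : Ω → ℝ≥0∞ := fun ω => ∫⁻ s, F s ω ∂μ
  set I := ∫⁻ ω, H ω ^ t ∂P with hI
  have hconj : t.HolderConjugate t.conjExponent := Real.HolderConjugate.conjExponent ht
  have ht1 : 0 < t - 1 := by linarith
  have key : I ≤ (∫⁻ s, (∫⁻ ω, F s ω ^ t ∂P) ^ (1 / t) ∂μ) * I ^ (1 / t.conjExponent) := by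
    calc I = ∫⁻ ω, ∫⁻ s, F s ω * H ω ^ (t - 1) ∂μ ∂P := by
          refine lintegral_congr fun ω => ?_
          have hFω : Measurable fun s => F s ω := hF.comp measurable_prodMk_right
          rw [lintegral_mul_const _ hFω]
          change H ω ^ t = H ω * H ω ^ (t - 1)
          conv_rhs => rw [← ENNReal.rpow_one (H ω)]
          rw [← ENNReal.rpow_mul, one_mul, ← ENNReal.rpow_add_of_nonneg _ _ zero_le_one ht1.le]
          congr 1
          ring
      _ = ∫⁻ s, ∫⁻ ω, F s ω * H ω ^ (t - 1) ∂P ∂μ := by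
          refine lintegral_lintegral_swap (f := fun ω s => F s ω * H ω ^ (t - 1)) ?_
          exact ((hF.comp measurable_swap).mul ((hH.comp measurable_fst).pow_const _)).aemeasurable
      _ ≤ ∫⁻ s, (∫⁻ ω, F s ω ^ t ∂P) ^ (1 / t) * I ^ (1 / t.conjExponent) ∂μ := by
          refine lintegral_mono fun s => ?_
          refine (ENNReal.lintegral_mul_le_Lp_mul_Lq P hconj (hFs s).aemeasurable
            (hH.pow_const (t - 1)).aemeasurable).trans_eq ?_
          congr 2
          refine lintegral_congr fun ω => ?_
          rw [← ENNReal.rpow_mul, Real.conjExponent, mul_div_cancel₀ _ ht1.ne']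
      _ = _ := lintegral_mul_const'' _
          ((hF.pow_const t).lintegral_prod_right'.pow_const _).aemeasurable
  rcases eq_or_ne I 0 with h0 | h0
  · rw [h0, ENNReal.zero_rpow_of_pos (by positivity)]
    exact zero_le
  have hsplit : I = I ^ (1 / t) * I ^ (1 / t.conjExponent) := by
    rw [← ENNReal.rpow_add _ _ h0 hfin, one_div, one_div, hconj.inv_add_inv_eq_one,
      ENNReal.rpow_one]
  have hne0 : I ^ (1 / t.conjExponent) ≠ 0 := by
    simp [ENNReal.rpow_eq_zero_iff, h0, hfin]
  have hnetop : I ^ (1 / t.conjExponent) ≠ ∞ :=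
    ENNReal.rpow_ne_top_of_nonneg (one_div_nonneg.2 hconj.symm.nonneg) hfin
  exact (ENNReal.mul_le_mul_iff_left hne0 hnetop).1 (hsplit.ge.trans key)

/-- The preceding inequality for `|g|^p` with exponent `t = q / p ≥ 1`. -/
theorem eLpNorm_eLpNorm_swap_le {g : S → Ω → ℝ} (hg : Measurable (Function.uncurry g)) {p q : ℝ≥0}
    (hp : 1 ≤ p) (hpq : p ≤ q)
    (hfin : eLpNorm (fun ω => eLpNorm (fun s => g s ω) p μ) q P ≠ ∞) :
    eLpNorm (fun ω => eLpNorm (fun s => g s ω) p μ) q P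
      ≤ eLpNorm (fun s => eLpNorm (g s) q P) p μ := by
  have hp0 : p ≠ 0 := (zero_lt_one.trans_le hp).ne'
  have hp0' : (0 : ℝ) < p := by positivity
  have hq0 : q ≠ 0 := (zero_lt_one.trans_le (hp.trans hpq)).ne'
  have hq0' : (0 : ℝ) < q := by positivity
  have ht : 1 ≤ (q : ℝ) / p := (one_le_div hp0').2 (by exact_mod_cast hpq)
  have hL : eLpNorm (fun ω => eLpNorm (fun s => g s ω) p μ) q P ^ (q : ℝ)
      = ∫⁻ ω, (∫⁻ s, ‖g s ω‖ₑ ^ (p : ℝ) ∂μ) ^ ((q : ℝ) / p) ∂P := by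
    rw [eLpNorm_nnreal_pow_eq_lintegral hq0]
    refine lintegral_congr fun ω => ?_
    rw [← eLpNorm_nnreal_pow_eq_lintegral (f := fun s => g s ω) hp0, ← ENNReal.rpow_mul,
      mul_div_cancel₀ _ hp0'.ne', enorm_eq_self]
  have hR : eLpNorm (fun s => eLpNorm (g s) q P) p μ ^ (p : ℝ)
      = ∫⁻ s, (∫⁻ ω, (‖g s ω‖ₑ ^ (p : ℝ)) ^ ((q : ℝ) / p) ∂P) ^ (1 / ((q : ℝ) / p)) ∂μ := by
    rw [eLpNorm_nnreal_pow_eq_lintegral hp0]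
    refine lintegral_congr fun s => ?_
    simp only [← ENNReal.rpow_mul, mul_div_cancel₀ _ hp0'.ne']
    rw [← eLpNorm_nnreal_pow_eq_lintegral (f := g s) hq0, ← ENNReal.rpow_mul, enorm_eq_self]
    congr 1
    field_simp
  have hfin' : ∫⁻ ω, (∫⁻ s, ‖g s ω‖ₑ ^ (p : ℝ) ∂μ) ^ ((q : ℝ) / p) ∂P ≠ ∞ := by
    rw [← hL]
    exact ENNReal.rpow_ne_top_of_nonneg hq0'.le hfin
  have h := lintegral_lintegral_rpow_le (μ := μ) (P := P) (F := fun s ω => ‖g s ω‖ₑ ^ (p : ℝ))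
    (hg.enorm.pow_const _) ht hfin'
  rw [← ENNReal.rpow_le_rpow_iff hp0', hR]
  refine le_trans (le_of_eq ?_) h
  rw [← hL, ← ENNReal.rpow_mul]
  congr 1
  field_simp

end Minkowski

/-! ### The estimate on a single level -/

theorem eLpNorm_ennreal_const_mul {S : Type*} [MeasurableSpace S] {μ : Measure S} {c : ℝ≥0∞}
    (hc : c ≠ ∞) (f : S → ℝ≥0∞) {p : ℝ≥0} (hp : p ≠ 0) :
    eLpNorm (fun s => c * f s) p μ = c * eLpNorm f p μ := by
  have hp0 : (0 : ℝ) < p := by positivity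
  refine (ENNReal.rpow_left_injective hp0.ne') ?_
  simp only [ENNReal.mul_rpow_of_nonneg _ _ hp0.le]
  rw [eLpNorm_nnreal_pow_eq_lintegral hp, eLpNorm_nnreal_pow_eq_lintegral hp]
  simp only [enorm_eq_self, ENNReal.mul_rpow_of_nonneg _ _ hp0.le]
  rw [lintegral_const_mul' _ _ (ENNReal.rpow_ne_top_of_nonneg hp0.le hc)]

section LevelBound

variable {S Ω : Type*} [MeasurableSpace S] [MeasurableSpace Ω] {μ : Measure S} {P : Measure Ω}

theorem IsJointVersion.eLpNorm_eq {p : ℝ≥0∞} {η : Ω → Lp ℝ p μ} {g : S → Ω → ℝ}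
    (hg : IsJointVersion P η g) (q : ℝ≥0∞) :
    eLpNorm η q P = eLpNorm (fun ω => eLpNorm (fun s => g s ω) p μ) q P := by
  refine eLpNorm_congr_enorm_ae ?_
  filter_upwards [hg.2] with ω hω
  rw [Lp.enorm_def, enorm_eq_self, eLpNorm_congr_ae hω]

theorem IsJointVersion.fun_sum {p : ℝ≥0∞} {ι : Type*} (t : Finset ι) {η : ι → Ω → Lp ℝ p μ}
    {g : ι → S → Ω → ℝ} (hg : ∀ i ∈ t, IsJointVersion P (η i) (g i)) :
    IsJointVersion P (fun ω => ∑ i ∈ t, η i ω) (fun s ω => ∑ i ∈ t, g i s ω) := by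
  refine ⟨Finset.measurable_fun_sum _ fun i hi => (hg i hi).1, ?_⟩
  have h : ∀ᵐ ω ∂P, ∀ i ∈ t, η i ω =ᵐ[μ] fun s => g i s ω :=
    (Finset.eventually_all t).2 fun i hi => (hg i hi).2
  filter_upwards [h] with ω hω
  have h2 : ∀ᵐ s ∂μ, ∀ i ∈ t, η i ω s = g i s ω := (Finset.eventually_all t).2 hω
  filter_upwards [Lp.coeFn_fun_finsetSum t fun i => η i ω, h2] with s hs1 hs2
  rw [hs1]
  exact Finset.sum_congr rfl hs2

theorem IsJointVersion.sub {p : ℝ≥0∞} {η₁ η₂ : Ω → Lp ℝ p μ} {g₁ g₂ : S → Ω → ℝ}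
    (h₁ : IsJointVersion P η₁ g₁) (h₂ : IsJointVersion P η₂ g₂) :
    IsJointVersion P (η₁ - η₂) (fun s => g₁ s - g₂ s) := by
  refine ⟨h₁.1.sub h₂.1, ?_⟩
  filter_upwards [h₁.2, h₂.2] with ω h1 h2
  filter_upwards [Lp.coeFn_sub (η₁ ω) (η₂ ω), h1, h2] with s hs hs1 hs2
  simp only [Pi.sub_apply] at hs ⊢
  rw [hs, hs1, hs2]

theorem isJointVersion_const {p : ℝ≥0∞} (f : Lp ℝ p μ) :
    IsJointVersion P (fun _ => f) (fun s _ => f s) :=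
  ⟨(Lp.stronglyMeasurable f).measurable.comp measurable_fst, ae_of_all _ fun _ => .rfl⟩

/-- A joint version of the identity with respect to the law of `η` is evaluated along `η`. -/
theorem IsJointVersion.comp_of_map_eq {p : ℝ≥0∞} [MeasurableSpace (Lp ℝ p μ)]
    {ν : Measure (Lp ℝ p μ)} {e : S → Lp ℝ p μ → ℝ} (he : IsJointVersion ν id e)
    {η η' : Ω → Lp ℝ p μ} (hη' : Measurable η') (hae : η =ᵐ[P] η') (hmap : P.map η = ν) :
    IsJointVersion P η (fun s ω => e s (η' ω)) := by
  refine ⟨he.1.comp (measurable_fst.prodMk (hη'.comp measurable_snd)), ?_⟩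
  rw [Measure.map_congr hae] at hmap
  subst hmap
  filter_upwards [ae_of_ae_map hη'.aemeasurable he.2, hae] with ω h1 h2
  rw [h2]
  exact h1

variable [SigmaFinite μ] [IsProbabilityMeasure P]

/-- Minkowski moves the `S`-norm outside; the scalar estimate then applies at almost every `s`, to
versions that are independent and identically distributed there. -/
theorem eLpNorm_sum_le_lpLqNorm {p q r : ℝ≥0} [Fact (1 ≤ (p : ℝ≥0∞))] (hpq : p ≤ q)
    (hr : 1 ≤ r) (hr2 : r ≤ 2) [MeasurableSpace (Lp ℝ p μ)] [BorelSpace (Lp ℝ p μ)] {M : ℕ}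
    {Z : Fin M → Ω → Lp ℝ p μ} {Y : Ω → Lp ℝ p μ} (hindep : iIndepFun Z P)
    (hZ : ∀ j, IdentDistrib (Z j) Y P P) (hY : MemLp Y q P) (h0 : ∫ ω, Y ω ∂P = 0) :
    eLpNorm (fun ω => ∑ j, Z j ω) q P
      ≤ 2 * khintchineB q * ((M : ℝ≥0∞) ^ (1 / (r : ℝ)) * lpLqNorm P Y (max q r : ℝ≥0)) := by
  have hp : 1 ≤ p := by exact_mod_cast (Fact.out : 1 ≤ (p : ℝ≥0∞))
  have hq : 1 ≤ q := hp.trans hpq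
  have hYm : AEMeasurable Y P := hY.1.aemeasurable
  have hYi : Integrable Y P := hY.integrable (by exact_mod_cast hq)
  -- `L^p(S)` need not be separable; the law of `Y` is nevertheless concentrated on a separable set
  -- because `Y` is strongly measurable.
  have hid : AEStronglyMeasurable id (P.map Y) :=
    (IdentDistrib.mk hYm aemeasurable_id (by rw [Measure.map_id]) :
      IdentDistrib Y id P (P.map Y)).aestronglyMeasurable_snd hY.1
  -- The same `e` is evaluated along `Y` and along every copy, so `e s` is one measurable function
  -- and preserves independence and equality of laws.
  obtain ⟨e, he⟩ := exists_isJointVersion hid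
  have hes : ∀ s, Measurable (e s) := fun s => he.1.comp measurable_prodMk_left
  set Y' : Ω → Lp ℝ p μ := hYm.mk Y
  have hYv : IsJointVersion P Y fun s ω => e s (Y' ω) :=
    he.comp_of_map_eq hYm.measurable_mk hYm.ae_eq_mk rfl
  set Z' : Fin M → Ω → Lp ℝ p μ := fun j => (hZ j).aemeasurable_fst.mk (Z j)
  have hZ' : ∀ j, Measurable (Z' j) := fun j => (hZ j).aemeasurable_fst.measurable_mk
  have hZZ' : ∀ j, Z j =ᵐ[P] Z' j := fun j => (hZ j).aemeasurable_fst.ae_eq_mk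
  have hZv : IsJointVersion P (fun ω => ∑ j, Z j ω) fun s ω => ∑ j, e s (Z' j ω) :=
    IsJointVersion.fun_sum _ fun j _ => he.comp_of_map_eq (hZ' j) (hZZ' j) (hZ j).map_eq
  have hindep' : iIndepFun Z' P := hindep.congr hZZ'
  have hident : ∀ j, IdentDistrib (Z' j) Y' P P := fun j =>
    (IdentDistrib.of_ae_eq (hZ j).aemeasurable_fst (hZZ' j)).symm.trans
      ((hZ j).trans (IdentDistrib.of_ae_eq hYm hYm.ae_eq_mk))
  -- Finiteness is needed for the cancellation in Minkowski's inequality.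
  have hfin : eLpNorm (fun ω => ∑ j, Z j ω) q P ≠ ∞ :=
    (memLp_finsetSum _ fun j _ => (hZ j).memLp_iff.2 hY).2.ne
  rw [hZv.eLpNorm_eq] at hfin ⊢
  refine (eLpNorm_eLpNorm_swap_le hZv.1 hp hpq hfin).trans ?_
  rw [lpLqNorm_eq hYv, ← mul_assoc, ← eLpNorm_ennreal_const_mul (p := p) _ _
    (zero_lt_one.trans_le hp).ne']
  · refine eLpNorm_mono_enorm_ae ?_
    filter_upwards [hYv.ae_integrable hYi, hYv.ae_integral_eq_zero hYi h0] with s hs1 hs2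
    rw [enorm_eq_self, enorm_eq_self, mul_assoc]
    exact eLpNorm_sum_le_of_identDistrib (fun j => (hes s).comp (hZ' j))
      (hindep'.comp (fun _ => e s) fun _ => hes s) (fun j => (hident j).comp (hes s)) hs1 hs2
      hq hr hr2
  · exact ENNReal.mul_ne_top (ENNReal.mul_ne_top (by simp) (by simp))
      (ENNReal.rpow_ne_top_of_nonneg (by positivity) (by simp))

end LevelBound

/-! ### Finiteness of the mixed norms -/

section Finiteness

variable {S Ω : Type*} [MeasurableSpace S] [MeasurableSpace Ω] {μ : Measure S} {P : Measure Ω}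

theorem measurable_eLpNorm_prodMk_left [SFinite P] {g : S → Ω → ℝ}
    (hg : Measurable (Function.uncurry g)) {q : ℝ≥0} (hq : q ≠ 0) :
    Measurable fun s => eLpNorm (g s) q P := by
  simp only [eLpNorm_eq_lintegral_rpow_enorm_toReal (ENNReal.coe_ne_zero.2 hq) ENNReal.coe_ne_top]
  exact (Measurable.lintegral_prod_right' (f := fun z : S × Ω => ‖Function.uncurry g z‖ₑ ^
    (q : ℝ≥0∞).toReal) (hg.enorm.pow_const _)).pow_const _

theorem MemLpLq.lpLqNorm_lt_top {p q : ℝ≥0∞} [Fact (1 ≤ q)] {η : Ω → Lp ℝ p μ}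
    (h : MemLpLq P η q) : lpLqNorm P η q < ∞ := by
  obtain ⟨g, hg, G, hGg, hG⟩ := h
  refine (iInf₂_le g hg).trans_lt (lt_of_eq_of_lt (eLpNorm_congr_enorm_ae ?_) hG.2)
  filter_upwards [hGg] with s hs
  rw [enorm_eq_self, Lp.enorm_def, eLpNorm_congr_ae hs]

theorem lpLqNorm_sub_le [SigmaFinite μ] [SigmaFinite P] {p : ℝ≥0∞} [hp : Fact (1 ≤ p)] {q : ℝ≥0}
    (hq : 1 ≤ q) {η₁ η₂ : Ω → Lp ℝ p μ} {g₁ g₂ : S → Ω → ℝ} (h₁ : IsJointVersion P η₁ g₁)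
    (h₂ : IsJointVersion P η₂ g₂) :
    lpLqNorm P (η₁ - η₂) q ≤ lpLqNorm P η₁ q + lpLqNorm P η₂ q := by
  have hq0 : q ≠ 0 := (zero_lt_one.trans_le hq).ne'
  rw [lpLqNorm_eq (h₁.sub h₂), lpLqNorm_eq h₁, lpLqNorm_eq h₂]
  refine le_trans (eLpNorm_mono_enorm (g := (fun s => eLpNorm (g₁ s) q P) +
    fun s => eLpNorm (g₂ s) q P) fun s => ?_)
    (eLpNorm_add_le (measurable_eLpNorm_prodMk_left h₁.1 hq0).aestronglyMeasurable
      (measurable_eLpNorm_prodMk_left h₂.1 hq0).aestronglyMeasurable hp.out)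
  rw [enorm_eq_self, enorm_eq_self]
  exact eLpNorm_sub_le (h₁.1.comp measurable_prodMk_left).aestronglyMeasurable
    (h₂.1.comp measurable_prodMk_left).aestronglyMeasurable (by exact_mod_cast hq)

theorem lpLqNorm_mono_exponent [SigmaFinite μ] [IsProbabilityMeasure P] {p : ℝ≥0∞}
    {q t : ℝ≥0∞} (hqt : q ≤ t) {η : Ω → Lp ℝ p μ} {g : S → Ω → ℝ} (h : IsJointVersion P η g) :
    lpLqNorm P η q ≤ lpLqNorm P η t := by
  rw [lpLqNorm_eq h, lpLqNorm_eq h]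
  refine eLpNorm_mono_enorm fun s => ?_
  rw [enorm_eq_self, enorm_eq_self]
  exact eLpNorm_le_eLpNorm_of_exponent_le hqt
    (h.1.comp measurable_prodMk_left).aestronglyMeasurable

theorem lpLqNorm_const_lt_top [SigmaFinite μ] [IsProbabilityMeasure P] {p : ℝ≥0∞}
    {q : ℝ≥0∞} (hq : q ≠ 0) (f : Lp ℝ p μ) : lpLqNorm P (fun _ => f) q < ∞ := by
  rw [lpLqNorm_eq (isJointVersion_const f)]
  refine lt_of_eq_of_lt (eLpNorm_congr_enorm_ae (ae_of_all _ fun s => ?_)) (Lp.memLp f).2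
  rw [eLpNorm_const _ hq (IsProbabilityMeasure.ne_zero P)]
  simp

end Finiteness

/-! ### The multilevel estimate -/

theorem mainTheorem8 {S : Type u} {Ω : Type v} [MeasurableSpace S] [MeasurableSpace Ω]
    (μ : Measure S) [SigmaFinite μ] (P : Measure Ω) [IsProbabilityMeasure P]
    (hS : ApproximationByAveraging.{u, v} μ)
    (p q qt : ℝ≥0) [Fact (1 ≤ (p : ℝ≥0∞))] [Fact (1 ≤ (qt : ℝ≥0∞))] (hpq : p ≤ q) (hqt : q ≤ qt)
    -- `L^p(S)` carries its Borel σ-algebra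
    [MeasurableSpace (Lp ℝ p μ)] [BorelSpace (Lp ℝ p μ)]
    (L : ℕ) (hL : 1 ≤ L)
    (X : ℕ → Ω → Lp ℝ p μ) (hX0 : X 0 = 0)
    (hX : ∀ l ∈ Finset.Icc 1 L, MemLp (X l) qt P ∧ MemLpLq P (X l) qt)
    (M : ℕ → ℕ) (hM : ∀ l ∈ Finset.Icc 1 L, 1 ≤ M l)
    -- `ξ l j`, `j < M l`, are independent copies of `X l - X (l - 1)`
    (ξ : (l : ℕ) → Fin (M l) → Ω → Lp ℝ p μ)
    (hξ_indep : ∀ l ∈ Finset.Icc 1 L, iIndepFun (ξ l) P)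
    (hξ_copy : ∀ l ∈ Finset.Icc 1 L, ∀ j, IdentDistrib (ξ l j) (X l - X (l - 1)) P P)
    (U : Lp ℝ p μ) (r : ℝ≥0) (hr : r ∈ Set.Icc (min q 2) (min qt 2)) :
    MemLp (fun ω => U - ∑ l ∈ Finset.Icc 1 L, (M l : ℝ)⁻¹ • ∑ j, ξ l j ω) q P ∧
    (∀ l ∈ Finset.Icc 1 L,
      lpLqNorm P (fun ω => (X l - X (l - 1)) ω - ∫ ω', (X l - X (l - 1)) ω' ∂P)
        (max q r : ℝ≥0) < ∞) ∧
    eLpNorm (fun ω => U - ∑ l ∈ Finset.Icc 1 L, (M l : ℝ)⁻¹ • ∑ j, ξ l j ω) q P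
      ≤ ‖U - ∫ ω, X L ω ∂P‖ₑ
        + 2 * (khintchineB q : ℝ≥0∞) * ∑ l ∈ Finset.Icc 1 L,
            (M l : ℝ≥0∞) ^ (-(1 - 1 / (r : ℝ))) *
              lpLqNorm P (fun ω => (X l - X (l - 1)) ω - ∫ ω', (X l - X (l - 1)) ω' ∂P)
                (max q r : ℝ≥0) := by
  have hp : 1 ≤ p := by exact_mod_cast (Fact.out : 1 ≤ (p : ℝ≥0∞))
  have hq : 1 ≤ q := hp.trans hpq
  have hq' : (1 : ℝ≥0∞) ≤ q := by exact_mod_cast hq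
  -- The range of `r` enters twice: `1 ≤ r ≤ 2` for the scalar estimate, and `max q r ≤ qt` for
  -- finiteness of the mixed norms.
  have hr1 : 1 ≤ r := le_trans (le_min hq (by norm_num)) hr.1
  have hr2 : r ≤ 2 := hr.2.trans (min_le_right _ _)
  have hmax : 1 ≤ max q r := hq.trans (le_max_left _ _)
  have hmaxqt : ((max q r : ℝ≥0) : ℝ≥0∞) ≤ qt := by
    exact_mod_cast max_le hqt (hr.2.trans (min_le_left _ _))
  -- the levels `0, …, L`
  have hXmem : ∀ l ≤ L, MemLp (X l) q P := fun l hl => by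
    rcases Nat.eq_zero_or_pos l with rfl | h
    · rw [hX0]; exact MemLp.zero
    · exact (hX l (Finset.mem_Icc.2 ⟨h, hl⟩)).1.mono_exponent (by exact_mod_cast hqt)
  have hXver : ∀ l ≤ L, ∃ g, IsJointVersion P (X l) g := fun l hl =>
    exists_isJointVersion (hXmem l hl).1
  have hXfin : ∀ l ≤ L, lpLqNorm P (X l) (max q r : ℝ≥0) < ∞ := fun l hl => by
    rcases Nat.eq_zero_or_pos l with rfl | h
    · rw [hX0]
      exact lpLqNorm_const_lt_top (by exact_mod_cast (zero_lt_one.trans_le hmax).ne') 0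
    · obtain ⟨g, hg⟩ := hXver l hl
      exact (lpLqNorm_mono_exponent hmaxqt hg).trans_lt
        (hX l (Finset.mem_Icc.2 ⟨h, hl⟩)).2.lpLqNorm_lt_top
  have hXint : ∀ l ≤ L, Integrable (X l) P := fun l hl => (hXmem l hl).integrable hq'
  have hle : ∀ l ∈ Finset.Icc 1 L, l ≤ L ∧ l - 1 ≤ L := fun l hl =>
    ⟨(Finset.mem_Icc.1 hl).2, (Nat.sub_le _ _).trans (Finset.mem_Icc.1 hl).2⟩
  have hdiff : ∀ l ∈ Finset.Icc 1 L, MemLp (X l - X (l - 1)) q P := fun l hl =>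
    (hXmem l (hle l hl).1).sub (hXmem _ (hle l hl).2)
  have hξmem : ∀ l ∈ Finset.Icc 1 L, ∀ j, MemLp (ξ l j) q P := fun l hl j =>
    (hξ_copy l hl j).memLp_iff.2 (hdiff l hl)
  refine ⟨?_, fun l hl => ?_, ?_⟩
  · exact (memLp_const U).sub (memLp_finsetSum _ fun l hl =>
      (memLp_finsetSum _ fun j _ => hξmem l hl j).const_smul ((M l : ℝ)⁻¹))
  · obtain ⟨g₁, h₁⟩ := hXver l (hle l hl).1
    obtain ⟨g₂, h₂⟩ := hXver (l - 1) (hle l hl).2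
    have h3 := lpLqNorm_sub_le hmax (h₁.sub h₂)
      (isJointVersion_const (∫ ω', (X l - X (l - 1)) ω' ∂P))
    refine h3.trans_lt (ENNReal.add_lt_top.2 ⟨(lpLqNorm_sub_le hmax h₁ h₂).trans_lt
      (ENNReal.add_lt_top.2 ⟨hXfin l (hle l hl).1, hXfin _ (hle l hl).2⟩), ?_⟩)
    exact lpLqNorm_const_lt_top (by exact_mod_cast (zero_lt_one.trans_le hmax).ne') _
  set m : ℕ → Lp ℝ p μ := fun l => ∫ ω', (X l - X (l - 1)) ω' ∂P with hm
  set D : (l : ℕ) → Ω → Lp ℝ p μ := fun l ω => ∑ j, (ξ l j ω - m l) with hD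
  have htel : ∑ l ∈ Finset.Icc 1 L, m l = ∫ ω, X L ω ∂P := by
    have h1 : ∀ l ∈ Finset.Icc 1 L, m l = ∫ ω, X l ω ∂P - ∫ ω, X (l - 1) ω ∂P := fun l hl =>
      integral_sub (hXint l (hle l hl).1) (hXint _ (hle l hl).2)
    rw [Finset.sum_congr rfl h1, ← Finset.Ico_add_one_right_eq_Icc,
      Finset.sum_Ico_eq_sum_range]
    simp only [add_tsub_cancel_right, add_comm 1]
    rw [Finset.sum_range_sub fun l => ∫ ω, X l ω ∂P, hX0]
    simp
  have hdecomp : (fun ω => U - ∑ l ∈ Finset.Icc 1 L, (M l : ℝ)⁻¹ • ∑ j, ξ l j ω)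
      = (fun _ => U - ∫ ω, X L ω ∂P) - ∑ l ∈ Finset.Icc 1 L, (M l : ℝ)⁻¹ • D l := by
    ext1 ω
    have h1 : ∀ l ∈ Finset.Icc 1 L, (M l : ℝ)⁻¹ • D l ω
        = (M l : ℝ)⁻¹ • ∑ j, ξ l j ω - m l := fun l hl => by
      have hM0 : (M l : ℝ) ≠ 0 := by exact_mod_cast (zero_lt_one.trans_le (hM l hl)).ne'
      simp only [hD, Finset.sum_sub_distrib, smul_sub, Finset.sum_const, Finset.card_univ,
        Fintype.card_fin]
      rw [← Nat.cast_smul_eq_nsmul ℝ, smul_smul, inv_mul_cancel₀ hM0, one_smul]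
    simp only [Pi.sub_apply, Finset.sum_apply, Pi.smul_apply]
    rw [Finset.sum_congr rfl h1, Finset.sum_sub_distrib, htel]
    abel
  have hDm : ∀ l ∈ Finset.Icc 1 L, MemLp (D l) q P := fun l hl =>
    memLp_finsetSum _ fun j _ => (hξmem l hl j).sub (memLp_const _)
  have hlevel : ∀ l ∈ Finset.Icc 1 L, eLpNorm ((M l : ℝ)⁻¹ • D l) q P
      ≤ 2 * khintchineB q * ((M l : ℝ≥0∞) ^ (-(1 - 1 / (r : ℝ))) *
        lpLqNorm P (fun ω => (X l - X (l - 1)) ω - m l) (max q r : ℝ≥0)) := fun l hl => by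
    have hM0 : M l ≠ 0 := (zero_lt_one.trans_le (hM l hl)).ne'
    -- Translation by the deterministic mean is Borel, so centring keeps the copies independent and
    -- identically distributed.
    have hmeas : Measurable fun x : Lp ℝ p μ => x - m l :=
      (continuous_id.sub continuous_const).measurable
    have h := eLpNorm_sum_le_lpLqNorm hpq hr1 hr2 (Y := fun ω => (X l - X (l - 1)) ω - m l)
      ((hξ_indep l hl).comp (fun _ x => x - m l) fun _ => hmeas)
      (fun j => (hξ_copy l hl j).comp hmeas) ((hdiff l hl).sub (memLp_const _)) (by
        rw [integral_sub ((hdiff l hl).integrable hq') (integrable_const _)]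
        simp [hm])
    rw [eLpNorm_const_smul]
    refine (mul_le_mul_right h _).trans_eq ?_
    -- The averaging factor `M^(-1)` and the growth `M^(1/r)` combine to the rate `M^(-(1 - 1/r))`.
    have hinv : ‖(M l : ℝ)⁻¹‖ₑ = (M l : ℝ≥0∞) ^ (-1 : ℝ) := by
      rw [enorm_inv (by exact_mod_cast hM0), ENNReal.rpow_neg_one]
      simp
    have hexp : -(1 - 1 / (r : ℝ)) = -1 + 1 / (r : ℝ) := by ring
    rw [hinv, hexp, ENNReal.rpow_add _ _ (by exact_mod_cast hM0) (by simp)]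
    ring
  rw [hdecomp]
  refine (eLpNorm_sub_le aestronglyMeasurable_const
    (Finset.aestronglyMeasurable_sum _ fun l hl => ((hDm l hl).1.const_smul _)) hq').trans ?_
  rw [Finset.mul_sum]
  refine add_le_add (le_of_eq ?_) ((eLpNorm_sum_le (fun l hl => (hDm l hl).1.const_smul _)
    hq').trans (Finset.sum_le_sum hlevel))
  rw [eLpNorm_const _ (by exact_mod_cast (zero_lt_one.trans_le hq).ne')
    (IsProbabilityMeasure.ne_zero P)]
  simp
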